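/- Let $\mathbb{K}=\mathbb{R}$ or $\mathbb{C}$ and let $A=(a_{ij})\in\mathbb{Z}^{n\times n}$ be a generalized Cartan matrix ($a_{ii}=2$, and for $i\neq j$: $a_{ij}\le 0$ and $a_{ij}=0\Leftrightarrow a_{ji}=0$) which is irreducible and simply-laced, i.e. $a_{ij}\in\{0,-1\}$ for all $i\neq j$; $A$ need not be invertible. Let $\mathfrak{h}$ be a $\mathbb{K}$-vector space of dimension $2n-\operatorname{rank}A$ with linearly independent simple roots $\alpha_1,\dots,\alpha_n\in\mathfrak{h}^*$ and linearly independent simple coroots $\alpha_1^\vee,\dots,\alpha_n^\vee\in\mathfrak{h}$ such that $\alpha_j(\alpha_i^\vee)=a_{ij}$. Let $\mathfrak{g}(A)=\mathfrak{g}(A)(\mathbb{K})$ be the Kac-Moody algebra, i.e. the Lie algebra generated by the vector space $\mathfrak{h}$ and elements $e_1,\dots,e_n,f_1,\dots,f_n$ subject to the relations $$[h,h']=0,\quad [h,e_j]=\alpha_j(h)e_j,\quad [h,f_j]=-\alpha_j(h)f_j,\quad [e_i,f_j]=\delta_{ij}\alpha_i^\vee \qquad (h,h'\in\mathfrak{h})$$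 and $\operatorname{ad}(e_i)^{1-a_{ij}}(e_j)=0=\operatorname{ad}(f_i)^{1-a_{ij}}(f_j)$ for $i\neq j$. Let $\beta\in\mathfrak{h}^*$ be a positive real root (i.e. $\beta$ lies in the orbit of a simple root under the Weyl group, which is generated by the reflections $\lambda\mapsto\lambda-\lambda(\alpha_i^\vee)\alpha_i$, and is a combination of simple roots with non-negative integer coefficients) with maximal support, i.e. $\beta=\sum_{i=1}^n k_i\alpha_i$ with all $k_i\neq 0$. Let $e_\beta\neq 0$ be an element of the root space $\mathfrak{g}_\beta=\{x\in\mathfrak{g}(A) : [h,x]=\beta(h)x \ \forall h\in\mathfrak{h}\}$. Then the Lie subalgebra of $\mathfrak{g}(A)$ generated by $e_\beta,f_1,\dots,f_n$ is the derived algebra: $$\langle e_\beta,f_1,\dots,f_n\rangle_{\mathbb{K}}=\mathfrak{g}'(A)(\mathbb{K})=[\mathfrak{g}(A)(\mathbb{K}),\mathfrak{g}(A)(\mathbb{K})].$$ -/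

import Mathlib

noncomputable section

namespace KacMoody

/-- A generalized Cartan matrix (GCM) of size `n`: an integer matrix with `a i i = 2`, and, for
`i ≠ j`, `a i j ≤ 0` and `a i j = 0 ↔ a j i = 0`. -/
structure GCM (n : ℕ) where
  /-- The underlying matrix. -/
  a : Matrix (Fin n) (Fin n) ℤ
  diag : ∀ i, a i i = 2
  nonpos : ∀ i j, i ≠ j → a i j ≤ 0
  zero_iff : ∀ i j, i ≠ j → (a i j = 0 ↔ a j i = 0)

variable {n : ℕ}

/-- `A` is simply-laced if all its off-diagonal entries are `0` or `-1`. -/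
def GCM.IsSimplyLaced (A : GCM n) : Prop :=
  ∀ i j, i ≠ j → A.a i j = 0 ∨ A.a i j = -1

/-- `A` is irreducible (indecomposable) if the index set is not the union of two disjoint nonempty
sets `s`, `sᶜ` with `a i j = 0` for all `i ∈ s`, `j ∉ s`. -/
def GCM.IsIrreducible (A : GCM n) : Prop :=
  ∀ s : Set (Fin n), s.Nonempty → sᶜ.Nonempty → ∃ i ∈ s, ∃ j ∈ sᶜ, A.a i j ≠ 0

/-- A (minimal) realization of the GCM `A` over `K`, on the vector space `H` (the Cartan
subalgebra): linearly independent simple coroots `α i ^∨ ∈ H` and simple roots `α i ∈ H*`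
with `α j (α i ^∨) = a i j`, where `dim H = 2 n - rank A`. For invertible `A` this says that the
simple coroots are a basis of `H`. -/
structure Realization (A : GCM n) (K : Type*) [Field K] (H : Type*) [AddCommGroup H]
    [Module K H] where
  /-- The simple coroots. -/
  coroot : Fin n → H
  /-- The simple roots. -/
  root : Fin n → Module.Dual K H
  finiteDimensional : FiniteDimensional K H
  linearIndependent_coroot : LinearIndependent K coroot
  linearIndependent_root : LinearIndependent K root
  root_coroot : ∀ i j, root j (coroot i) = (A.a i j : K)
  finrank_add_rank : Module.finrank K H + (A.a.map (Int.cast : ℤ → K)).rank = 2 * n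

/-- Every GCM has a realization: on `K ^ n × (ker A)*`. -/
theorem Realization.nonempty (A : GCM n) (K : Type*) [Field K] :
    Nonempty (Realization A K
      ((Fin n → K) × Module.Dual K
        (LinearMap.ker (A.a.map (Int.cast : ℤ → K)).mulVecLin))) := by
  classical
  set M : Matrix (Fin n) (Fin n) K := A.a.map (Int.cast : ℤ → K) with hM
  obtain ⟨p, hp⟩ := (LinearMap.ker M.mulVecLin).exists_isCompl
  let π := (LinearMap.ker M.mulVecLin).projectionOnto p hp
  let r : Fin n → Module.Dual K ((Fin n → K) × Module.Dual K (LinearMap.ker M.mulVecLin)) :=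
    fun j => (∑ i, M i j • (LinearMap.proj i : (Fin n → K) →ₗ[K] K)).coprod
      (Module.Dual.eval K _ (π (Pi.single j 1)))
  refine ⟨⟨fun i => (Pi.single i 1, 0), r, inferInstance, ?_, ?_, ?_, ?_⟩⟩
  · have := (Pi.basisFun K (Fin n)).linearIndependent.map'
      (LinearMap.inl K (Fin n → K) (Module.Dual K (LinearMap.ker M.mulVecLin)))
      (LinearMap.ker_eq_bot.2 LinearMap.inl_injective)
    have he : (fun i : Fin n => ((Pi.single i 1 : Fin n → K),
        (0 : Module.Dual K (LinearMap.ker M.mulVecLin)))) =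
        LinearMap.inl K (Fin n → K) (Module.Dual K (LinearMap.ker M.mulVecLin)) ∘
          Pi.basisFun K (Fin n) := by
      funext i
      simp
    rw [he]
    exact this
  · rw [Fintype.linearIndependent_iff]
    intro c hc
    have hk : M.mulVec c = 0 := by
      funext i
      have h := LinearMap.congr_fun hc (Pi.single i 1, 0)
      simpa [r, Matrix.mulVec, dotProduct, Pi.single_apply, mul_comm] using h
    have hπ : π c = 0 := by
      rw [← Module.forall_dual_apply_eq_zero_iff K]
      intro ψ
      have h := LinearMap.congr_fun hc (0, ψ)
      have hcs : c = ∑ j, c j • (Pi.single j 1 : Fin n → K) := by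
        funext i
        simp [Finset.sum_apply, Pi.single_apply]
      rw [hcs, map_sum, map_sum]
      simpa [r] using h
    have hc0 : c = 0 := by
      have h := Submodule.projectionOnto_apply_left hp ⟨c, by simpa using hk⟩
      rw [show (LinearMap.ker M.mulVecLin).projectionOnto p hp c = 0 from hπ] at h
      simpa using (congrArg Subtype.val h).symm
    intro i
    simp [hc0]
  · intro i j
    simp [r, hM, Pi.single_apply]
  · have h := LinearMap.finrank_range_add_finrank_ker M.mulVecLin
    simp only [Module.finrank_fin_fun] at h
    have h2 : Module.finrank K ((Fin n → K) × Module.Dual K (LinearMap.ker M.mulVecLin)) =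
        n + Module.finrank K (LinearMap.ker M.mulVecLin) := by
      rw [Module.finrank_prod, Subspace.dual_finrank_eq, Module.finrank_fin_fun]
    have h3 : M.rank = Module.finrank K (LinearMap.range M.mulVecLin) := rfl
    change Module.finrank K ((Fin n → K) × Module.Dual K (LinearMap.ker M.mulVecLin)) + M.rank = _
    omega

/-- Generators of the Kac-Moody algebra: the elements of the Cartan subalgebra `H` and the
Chevalley generators `e i`, `f i`. -/
inductive Generator (n : ℕ) (H : Type*)
  | h : H → Generator n H
  | e : Fin n → Generator n H
  | f : Fin n → Generator n H

variable {A : GCM n} {K : Type*} [Field K] {H : Type*} [AddCommGroup H] [Module K H]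

namespace Realization

variable (R : Realization A K H)

local notation "hh" x => FreeLieAlgebra.of K (Generator.h x : Generator n H)
local notation "ee" x => FreeLieAlgebra.of K (Generator.e x : Generator n H)
local notation "ff" x => FreeLieAlgebra.of K (Generator.f x : Generator n H)

/-- The defining relators of the Kac-Moody algebra. The first two make `H → 𝔤(A)` linear; then
come `[h, h'] = 0`, `[h, e j] = α j (h) e j`, `[h, f j] = - α j (h) f j`,
`[e i, f j] = δ i j α i ^∨`, and the Serre relations. -/
inductive Relator : FreeLieAlgebra K (Generator n H) → Prop
  | h_add (x y : H) : Relator ((hh (x + y)) - (hh x) - (hh y))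
  | h_smul (c : K) (x : H) : Relator ((hh (c • x)) - c • (hh x))
  | h_h (x y : H) : Relator ⁅hh x, hh y⁆
  | h_e (x : H) (j : Fin n) : Relator (⁅hh x, ee j⁆ - R.root j x • (ee j))
  | h_f (x : H) (j : Fin n) : Relator (⁅hh x, ff j⁆ + R.root j x • (ff j))
  | e_f_same (i : Fin n) : Relator (⁅ee i, ff i⁆ - (hh (R.coroot i)))
  | e_f_ne (i j : Fin n) (hij : i ≠ j) : Relator ⁅ee i, ff j⁆
  | serre_e (i j : Fin n) (hij : i ≠ j) :
      Relator (((LieAlgebra.ad K (FreeLieAlgebra K (Generator n H)) (ee i)) ^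
        (1 - A.a i j).toNat) (ee j))
  | serre_f (i j : Fin n) (hij : i ≠ j) :
      Relator (((LieAlgebra.ad K (FreeLieAlgebra K (Generator n H)) (ff i)) ^
        (1 - A.a i j).toNat) (ff j))

/-- The Lie ideal of the free Lie algebra generated by the relators. -/
def relationIdeal : LieIdeal K (FreeLieAlgebra K (Generator n H)) :=
  LieSubmodule.lieSpan K _ {x | R.Relator x}

/-- The Kac-Moody algebra `𝔤(A)(K)`. -/
abbrev Algebra : Type _ := FreeLieAlgebra K (Generator n H) ⧸ R.relationIdeal

/-- The image in `𝔤(A)` of an element of the Cartan subalgebra. -/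
def h (x : H) : R.Algebra := LieSubmodule.Quotient.mk (hh x)

/-- The Chevalley generator `e i`. -/
def e (i : Fin n) : R.Algebra := LieSubmodule.Quotient.mk (ee i)

/-- The Chevalley generator `f i`. -/
def f (i : Fin n) : R.Algebra := LieSubmodule.Quotient.mk (ff i)

/-- The root space `𝔤_β = {x | [h, x] = β(h) x for all h ∈ H}`. -/
def rootSpace (β : Module.Dual K H) : Submodule K R.Algebra where
  carrier := {x | ∀ t : H, ⁅R.h t, x⁆ = β t • x}
  add_mem' hx hy t := by rw [lie_add, hx t, hy t, smul_add]
  zero_mem' t := by rw [lie_zero, smul_zero]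
  smul_mem' c x hx t := by rw [lie_smul, hx t, smul_comm]

/-- The derived algebra `𝔤'(A) = [𝔤(A), 𝔤(A)]`, as a Lie subalgebra of `𝔤(A)`. -/
def derivedAlgebra : LieSubalgebra K R.Algebra :=
  (LieAlgebra.derivedSeries K R.Algebra 1).toLieSubalgebra

/-- The simple reflection `r i : λ ↦ λ - λ(α i ^∨) α i` of `H*`. -/
def simpleReflection (i : Fin n) : Module.Dual K H ≃ₗ[K] Module.Dual K H :=
  Module.reflection (x := R.root i) (f := Module.Dual.eval K H (R.coroot i))
    (by simp [R.root_coroot, A.diag])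

/-- The Weyl group, generated by the simple reflections. -/
def weylGroup : Subgroup (Module.Dual K H ≃ₗ[K] Module.Dual K H) :=
  Subgroup.closure (Set.range R.simpleReflection)

/-- `β` is a real root: it is the image of a simple root under an element of the Weyl group. -/
def IsRealRoot (β : Module.Dual K H) : Prop :=
  ∃ w ∈ R.weylGroup, ∃ i, β = w (R.root i)

/-- `β` is a combination of the simple roots with coefficients in the natural numbers. -/
def IsPositive (β : Module.Dual K H) : Prop :=
  ∃ k : Fin n → ℕ, β = ∑ i, k i • R.root i

/-- `β` has maximal support: in its decomposition into simple roots all (integer) coefficients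
are nonzero. -/
def HasMaximalSupport (β : Module.Dual K H) : Prop :=
  ∃ k : Fin n → ℤ, β = ∑ i, k i • R.root i ∧ ∀ i, k i ≠ 0

end Realization

end KacMoody

end

/-! Let `L` be a Lie subalgebra containing all `f i` and a root vector `u` of a positive real root
`γ`. Induction on the height of `γ` shows that `L` contains `e l` for every `l` in the support of
`γ` (`e_mem_of_root_vector_mem`). For full support `L` then contains all Chevalley generators, hence
the derived algebra.

As `A` is symmetric, `k ↦ ∑ k i a i j k j` is Weyl-invariant and equals 2 on real roots. So some `i`
in the support has `γ(α i ^∨) = m + 1 > 0`, and by sl₂-theory `u' = ad(f i)^(m+1) u` is a nonzero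
root vector of `r i γ`, which is positive of smaller height unless `γ` is simple (`exists_descent`).
Since `u' ∈ L`, induction gives `e l ∈ L` for all `l` in the support of `r i γ`. Only `e i` can be
missing, namely when `i` has left the support. Then `⁅e i, u'⁆` is a multiple of `ad(f i)^m u`, so
it lies in `L`.

It remains to extract `e i` from `⁅e i, u'⁆`. This is `mem_of_lie_mem`, stated for any vector `z`
killed by the relevant `f l` and of nontrivial weight: such an `f l` commutes with `ad z`, so `u'`
can be lowered inside the bracket down to a simple root vector `e j`, and `⁅f j, ⁅z, e j⁆⁆` is a
multiple of `z`. -/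

noncomputable section

namespace KacMoody

/-! ### Representations of sl₂ with locally nilpotent raising operator -/

section SlTwo

variable {K V : Type*} [Field K] [AddCommGroup V] [Module K V] {E F T : Module.End K V}

theorem sl2_pow_weight (hTF : ∀ x, T (F x) = F (T x) - (2 : K) • F x) {μ : K} {v : V}
    (hv : T v = μ • v) (m : ℕ) : T ((F ^ m) v) = (μ - 2 * m) • (F ^ m) v := by
  induction m with
  | zero => simp [hv]
  | succ m ih =>
    rw [pow_succ', Module.End.mul_apply, hTF, ih, map_smul, ← sub_smul]
    congr 1
    push_cast
    ring

theorem sl2_raise_pow_lower (hEF : ∀ x, E (F x) = F (E x) + T x)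
    (hTF : ∀ x, T (F x) = F (T x) - (2 : K) • F x) {μ : K} {v : V} (hv : T v = μ • v) (m : ℕ) :
    E ((F ^ (m + 1)) v) = (F ^ (m + 1)) (E v) + ((m + 1) * (μ - m) : K) • (F ^ m) v := by
  induction m with
  | zero => simp [hEF, hv]
  | succ m ih =>
    rw [pow_succ' F (m + 1), Module.End.mul_apply, hEF, ih, sl2_pow_weight hTF hv, map_add,
      map_smul, Module.End.mul_apply, ← Module.End.mul_apply F (F ^ m), ← pow_succ', add_assoc,
      ← add_smul]
    congr 2
    push_cast
    ring

/-- If `E` is nilpotent on a vector `v` of weight `m ≥ 0`, then `F ^ m` does not kill `v`. -/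
theorem sl2_eq_zero_of_pow_lower_eq_zero [CharZero K] (hEF : ∀ x, E (F x) = F (E x) + T x)
    (hTE : ∀ x, T (E x) = E (T x) + (2 : K) • E x)
    (hTF : ∀ x, T (F x) = F (T x) - (2 : K) • F x) (N : ℕ) :
    ∀ (m : ℕ) (v : V), T v = (m : K) • v → (E ^ N) v = 0 → (F ^ m) v = 0 → v = 0 := by
  induction N with
  | zero => intro m v _ h _; simpa using h
  | succ N ih =>
    intro m v hv hE hF
    have hEv : E v = 0 := by
      refine ih (m + 2) (E v) ?_ (by simpa [pow_succ] using hE) ?_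
      · rw [hTE, hv, map_smul, ← add_smul]
        push_cast
        rfl
      -- Commuting `E` past `F ^ (m + 2)` costs a multiple of `F ^ (m + 1) v`, which vanishes along
      -- with `F ^ m v`.
      · have h := sl2_raise_pow_lower hEF hTF hv (m + 1)
        have h1 : (F ^ (m + 1)) v = 0 := by rw [pow_succ', Module.End.mul_apply, hF, map_zero]
        have h2 : (F ^ (m + 1 + 1)) v = 0 := by
          rw [pow_succ', Module.End.mul_apply, h1, map_zero]
        rw [h1, h2, map_zero, smul_zero, add_zero] at h
        exact h.symm
    -- As `E v = 0`, applying `E` to `F ^ (r + 1) v` gives `(r + 1) (m - r) F ^ r v`, with nonzero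
    -- coefficient for `r < m`.
    have hdown : ∀ j ≤ m, (F ^ (m - j)) v = 0 := by
      intro j
      induction j with
      | zero => intro _; simpa using hF
      | succ j ihj =>
        intro hj
        have h := sl2_raise_pow_lower hEF hTF hv (m - (j + 1))
        rw [show m - (j + 1) + 1 = m - j by omega, ihj (by omega), hEv, map_zero, map_zero,
          zero_add] at h
        refine (smul_eq_zero.1 h.symm).resolve_left (mul_ne_zero ?_ ?_)
        · exact Nat.cast_add_one_ne_zero _
        · rw [Nat.cast_sub hj, sub_sub_cancel]
          exact Nat.cast_ne_zero.2 (Nat.succ_ne_zero j)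
    simpa using hdown m le_rfl

/-- If `F ^ (m + 2)` kills a vector `v` of weight `m + 1` on which `E` is nilpotent, then
`F ^ m v` is a multiple of `E (F ^ (m + 1) v)`. -/
theorem sl2_raise_lowest [CharZero K] (hEF : ∀ x, E (F x) = F (E x) + T x)
    (hTE : ∀ x, T (E x) = E (T x) + (2 : K) • E x)
    (hTF : ∀ x, T (F x) = F (T x) - (2 : K) • F x) {N m : ℕ} {v : V}
    (hv : T v = ((m + 1 : ℕ) : K) • v) (hE : (E ^ N) v = 0) (hF : (F ^ (m + 2)) v = 0) :
    E ((F ^ (m + 1)) v) = ((m + 1 : ℕ) : K) • (F ^ m) v := by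
  -- `E v` has weight `m + 3` and is killed by `F ^ (m + 3)`, so the preceding injectivity applies.
  have hEv : E v = 0 := by
    refine sl2_eq_zero_of_pow_lower_eq_zero hEF hTE hTF N (m + 3) (E v) ?_ ?_ ?_
    · rw [hTE, hv, map_smul, ← add_smul]
      push_cast
      congr 1
      ring
    · rw [← Module.End.mul_apply, ← pow_succ, pow_succ', Module.End.mul_apply, hE, map_zero]
    · have h := sl2_raise_pow_lower hEF hTF hv (m + 2)
      rw [pow_succ' F (m + 2), Module.End.mul_apply, hF, map_zero, map_zero, smul_zero,
        add_zero, ← pow_succ'] at h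
      exact h.symm
  rw [sl2_raise_pow_lower hEF hTF hv, hEv, map_zero, zero_add]
  congr 1
  push_cast
  ring

end SlTwo

variable {n : ℕ} {A : GCM n} {K : Type*} [Field K] {H : Type*} [AddCommGroup H] [Module K H]

/-! ### Relations in the Kac-Moody algebra and local nilpotence -/

namespace Realization

variable (R : Realization A K H)

theorem mk_eq_zero_of_relator {x : FreeLieAlgebra K (Generator n H)} (hx : R.Relator x) :
    (LieSubmodule.Quotient.mk x : R.Algebra) = 0 :=
  LieSubmodule.Quotient.mk_eq_zero'.2 (LieSubmodule.subset_lieSpan hx)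

/-- The quotient map from the free Lie algebra onto the Kac-Moody algebra. -/
def proj : FreeLieAlgebra K (Generator n H) →ₗ⁅K⁆ R.Algebra :=
  { (LieSubmodule.Quotient.mk' R.relationIdeal : _ →ₗ[K] R.Algebra) with
    map_lie' := fun {_ _} => rfl }

theorem proj_surjective : Function.Surjective R.proj :=
  LieSubmodule.Quotient.surjective_mk' R.relationIdeal

theorem proj_relator {x : FreeLieAlgebra K (Generator n H)} (hx : R.Relator x) :
    R.proj x = 0 := R.mk_eq_zero_of_relator hx

theorem proj_ad_pow (x y : FreeLieAlgebra K (Generator n H)) (N : ℕ) :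
    R.proj ((LieAlgebra.ad K _ x ^ N) y) = (LieAlgebra.ad K _ (R.proj x) ^ N) (R.proj y) := by
  induction N with
  | zero => simp
  | succ N ih => simp [pow_succ', ih]

theorem proj_h (x : H) : R.proj (FreeLieAlgebra.of K (Generator.h x)) = R.h x := rfl
theorem proj_e (i : Fin n) : R.proj (FreeLieAlgebra.of K (Generator.e i)) = R.e i := rfl
theorem proj_f (i : Fin n) : R.proj (FreeLieAlgebra.of K (Generator.f i)) = R.f i := rfl

/-- The map from the Cartan subalgebra to the Kac-Moody algebra, as a linear map. -/
def hLin : H →ₗ[K] R.Algebra where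
  toFun := R.h
  map_add' x y := by
    have h := R.proj_relator (.h_add x y)
    rw [map_sub, map_sub, sub_sub, sub_eq_zero] at h
    exact h
  map_smul' c x := by
    have h := R.proj_relator (.h_smul c x)
    rw [map_sub, map_smul, sub_eq_zero] at h
    exact h

theorem hLin_apply (x : H) : R.hLin x = R.h x := rfl

theorem lie_h_h (x y : H) : ⁅R.h x, R.h y⁆ = 0 := by
  have h := R.proj_relator (.h_h x y)
  rwa [LieHom.map_lie] at h

theorem lie_h_e (x : H) (j : Fin n) : ⁅R.h x, R.e j⁆ = R.root j x • R.e j := by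
  have h := R.proj_relator (.h_e x j)
  rwa [map_sub, map_smul, LieHom.map_lie, sub_eq_zero] at h

theorem lie_h_f (x : H) (j : Fin n) : ⁅R.h x, R.f j⁆ = -(R.root j x • R.f j) := by
  have h := R.proj_relator (.h_f x j)
  rwa [map_add, map_smul, LieHom.map_lie, ← eq_neg_iff_add_eq_zero] at h

theorem lie_e_f_same (i : Fin n) : ⁅R.e i, R.f i⁆ = R.h (R.coroot i) := by
  have h := R.proj_relator (.e_f_same i)
  rwa [map_sub, LieHom.map_lie, sub_eq_zero] at h

theorem lie_e_f_ne {i j : Fin n} (hij : i ≠ j) : ⁅R.e i, R.f j⁆ = 0 := by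
  have h := R.proj_relator (.e_f_ne i j hij)
  rwa [LieHom.map_lie] at h

theorem serre_e {i j : Fin n} (hij : i ≠ j) :
    (LieAlgebra.ad K R.Algebra (R.e i) ^ (1 - A.a i j).toNat) (R.e j) = 0 := by
  have h := R.proj_relator (.serre_e i j hij)
  rwa [proj_ad_pow] at h

/-- The Kac-Moody algebra is generated by the Cartan subalgebra and the Chevalley generators. -/
theorem eq_top_of_generators_mem {S : LieSubalgebra K R.Algebra} (hh : ∀ x, R.h x ∈ S)
    (he : ∀ i, R.e i ∈ S) (hf : ∀ i, R.f i ∈ S) : S = ⊤ := by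
  let φ : FreeLieAlgebra K (Generator n H) →ₗ⁅K⁆ S := FreeLieAlgebra.lift K fun g =>
    match g with
    | .h x => ⟨R.h x, hh x⟩
    | .e i => ⟨R.e i, he i⟩
    | .f i => ⟨R.f i, hf i⟩
  have hφ : S.incl.comp φ = R.proj := by
    refine FreeLieAlgebra.hom_ext fun g => ?_
    cases g <;> simp [φ, proj_h, proj_e, proj_f]
  rw [eq_top_iff]
  intro x _
  obtain ⟨y, rfl⟩ := R.proj_surjective x
  rw [← hφ]
  exact (φ y).2

/-- The vectors on which `ad (e i)` is nilpotent form the Engel subalgebra, so it suffices to check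
generators; on `e j` this is the Serre relation. -/
theorem exists_ad_e_pow_eq_zero (i : Fin n) (x : R.Algebra) :
    ∃ N : ℕ, (LieAlgebra.ad K R.Algebra (R.e i) ^ N) x = 0 := by
  have h : LieSubalgebra.engel K (R.e i) = ⊤ := by
    refine R.eq_top_of_generators_mem (fun x => ?_) (fun j => ?_) (fun j => ?_) <;>
      rw [LieSubalgebra.mem_engel_iff]
    · refine ⟨2, ?_⟩
      rw [pow_two, Module.End.mul_apply, LieAlgebra.ad_apply, LieAlgebra.ad_apply,
        ← lie_skew (R.e i) (R.h x), lie_h_e, lie_neg, lie_smul, lie_self, smul_zero, neg_zero]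
    · rcases eq_or_ne i j with rfl | hij
      · exact ⟨1, by simp⟩
      · exact ⟨_, R.serre_e hij⟩
    · rcases eq_or_ne i j with rfl | hij
      · refine ⟨3, ?_⟩
        rw [pow_succ', pow_two, Module.End.mul_apply, Module.End.mul_apply, LieAlgebra.ad_apply,
          LieAlgebra.ad_apply, LieAlgebra.ad_apply, lie_e_f_same,
          ← lie_skew (R.e i) (R.h (R.coroot i)), lie_h_e, lie_neg, lie_smul, lie_self, smul_zero,
          neg_zero]
      · exact ⟨1, by simpa using R.lie_e_f_ne hij⟩
  rw [← LieSubalgebra.mem_engel_iff, h]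
  trivial

end Realization

theorem lie_mem_of_mem_span {K L : Type*} [CommRing K] [LieRing L] [LieAlgebra K L] {S T : Set L}
    {P : Submodule K L} (h : ∀ a ∈ S, ∀ b ∈ T, ⁅a, b⁆ ∈ P) {x y : L}
    (hx : x ∈ Submodule.span K S) (hy : y ∈ Submodule.span K T) : ⁅x, y⁆ ∈ P := by
  induction hx, hy using Submodule.span_induction₂ with
  | mem_mem a b ha hb => exact h a ha b hb
  | zero_left y hy => rw [zero_lie]; exact P.zero_mem
  | zero_right x hx => rw [lie_zero]; exact P.zero_mem
  | add_left x y z hx hy hz h1 h2 => rw [add_lie]; exact P.add_mem h1 h2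
  | add_right x y z hx hy hz h1 h2 => rw [lie_add]; exact P.add_mem h1 h2
  | smul_left r x y hx hy h => rw [smul_lie]; exact P.smul_mem r h
  | smul_right r x y hx hy h => rw [lie_smul]; exact P.smul_mem r h

/-! ### Weights, triangular decomposition and root spaces -/

namespace Realization

variable (R : Realization A K H)

/-- The weight with given integral coordinates with respect to the simple roots. -/
def wt (k : Fin n → ℤ) : Module.Dual K H := ∑ i, k i • R.root i

theorem wt_add (k l : Fin n → ℤ) : R.wt (k + l) = R.wt k + R.wt l := by
  simp [wt, add_smul, Finset.sum_add_distrib]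

theorem wt_single (i : Fin n) (c : ℤ) : R.wt (Pi.single i c) = c • R.root i := by
  rw [wt, Finset.sum_eq_single i] <;> simp +contextual

theorem wt_injective [CharZero K] : Function.Injective R.wt := by
  intro k l h
  have h0 : ∑ i, ((k i - l i : ℤ) : K) • R.root i = 0 := by
    rw [Finset.sum_congr rfl fun i _ => (LinearMap.ext fun t => by simp [sub_mul] :
      ((k i - l i : ℤ) : K) • R.root i = k i • R.root i - l i • R.root i),
      Finset.sum_sub_distrib]
    exact sub_eq_zero.2 h
  funext i
  have := Fintype.linearIndependent_iff.1 R.linearIndependent_root _ h0 i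
  exact sub_eq_zero.1 (by exact_mod_cast this)

theorem wt_coroot (k : Fin n → ℤ) (i : Fin n) :
    R.wt k (R.coroot i) = ((∑ j, A.a i j * k j : ℤ) : K) := by
  simp only [wt, LinearMap.sum_apply, LinearMap.smul_apply, R.root_coroot, zsmul_eq_mul]
  push_cast
  exact Finset.sum_congr rfl fun j _ => mul_comm _ _

theorem lie_mem_rootSpace {β γ : Module.Dual K H} {x y : R.Algebra} (hx : x ∈ R.rootSpace β)
    (hy : y ∈ R.rootSpace γ) : ⁅x, y⁆ ∈ R.rootSpace (β + γ) := by
  intro t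
  rw [leibniz_lie, hx t, hy t, smul_lie, lie_smul, ← add_smul, LinearMap.add_apply]

theorem e_mem_rootSpace (i : Fin n) : R.e i ∈ R.rootSpace (R.wt (Pi.single i 1)) := by
  intro t
  rw [lie_h_e, wt_single, one_smul]

theorem f_mem_rootSpace (i : Fin n) : R.f i ∈ R.rootSpace (R.wt (-Pi.single i 1)) := by
  intro t
  rw [lie_h_f, ← Pi.single_neg, wt_single, neg_smul, one_smul, LinearMap.neg_apply, neg_smul]

/-- A Lie subalgebra generated by vectors of weights `s α j` is spanned by these vectors and by
weight vectors of weight `s γ`, with `γ ≥ 0` of height at least two. -/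
theorem lieSpan_le_span (s : ℤ) (x : Fin n → R.Algebra)
    (hx : ∀ j, x j ∈ R.rootSpace (R.wt (s • Pi.single j 1))) {y : R.Algebra}
    (hy : y ∈ LieSubalgebra.lieSpan K R.Algebra (Set.range x)) :
    y ∈ Submodule.span K (Set.range x ∪
      {y | ∃ k : Fin n → ℤ, 0 ≤ k ∧ 2 ≤ ∑ i, k i ∧ y ∈ R.rootSpace (R.wt (s • k))}) := by
  induction hy using LieSubalgebra.lieSpan_induction with
  | mem y hy => exact Submodule.subset_span (Or.inl hy)
  | zero => exact Submodule.zero_mem _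
  | add y z _ _ h1 h2 => exact Submodule.add_mem _ h1 h2
  | smul c y _ h => exact Submodule.smul_mem _ c h
  | lie y z _ _ h1 h2 =>
    have key : ∀ a ∈ Set.range x ∪
        {y | ∃ k : Fin n → ℤ, 0 ≤ k ∧ 2 ≤ ∑ i, k i ∧ y ∈ R.rootSpace (R.wt (s • k))},
        ∃ k : Fin n → ℤ, 0 ≤ k ∧ 1 ≤ ∑ i, k i ∧ a ∈ R.rootSpace (R.wt (s • k)) := by
      rintro a (⟨j, rfl⟩ | ⟨k, h0, h2, hk⟩)
      · exact ⟨Pi.single j 1, by simp [Pi.single_nonneg], by simp, hx j⟩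
      · exact ⟨k, h0, by omega, hk⟩
    refine lie_mem_of_mem_span (fun a ha b hb => ?_) h1 h2
    refine Submodule.subset_span (Or.inr ?_)
    obtain ⟨k, hk0, hk1, hk⟩ := key a ha
    obtain ⟨l, hl0, hl1, hl⟩ := key b hb
    refine ⟨k + l, add_nonneg hk0 hl0, ?_, ?_⟩
    · simp only [Pi.add_apply, Finset.sum_add_distrib]
      omega
    · rw [smul_add, wt_add]
      exact R.lie_mem_rootSpace hk hl

theorem lie_h_mem_lieSpan {x : Fin n → R.Algebra} {β : Fin n → Module.Dual K H}
    (hx : ∀ j, x j ∈ R.rootSpace (β j)) (t : H) {z : R.Algebra}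
    (hz : z ∈ LieSubalgebra.lieSpan K R.Algebra (Set.range x)) :
    ⁅R.h t, z⁆ ∈ LieSubalgebra.lieSpan K R.Algebra (Set.range x) := by
  induction hz using LieSubalgebra.lieSpan_induction with
  | mem y hy =>
    obtain ⟨j, rfl⟩ := hy
    rw [hx j t]
    exact LieSubalgebra.smul_mem _ _ (LieSubalgebra.subset_lieSpan ⟨j, rfl⟩)
  | zero => rw [lie_zero]; exact zero_mem _
  | add y z _ _ h1 h2 => rw [lie_add]; exact add_mem h1 h2
  | smul c y _ h => rw [lie_smul]; exact LieSubalgebra.smul_mem _ _ h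
  | lie y z hy hz h1 h2 =>
    rw [leibniz_lie]
    exact add_mem (LieSubalgebra.lie_mem _ h1 hz) (LieSubalgebra.lie_mem _ hy h2)

/-- Used with `y = f i` on the `e j` and with `y = e i` on the `f j`: bracketing with an opposite
generator does not leave `𝔥 + 𝔫₊`, respectively `𝔥 + 𝔫₋`. -/
theorem lie_mem_lieSpan_sup_range {x : Fin n → R.Algebra} {β : Fin n → Module.Dual K H}
    (hx : ∀ j, x j ∈ R.rootSpace (β j)) {y : R.Algebra}
    (hy : ∀ j, ⁅y, x j⁆ ∈ LinearMap.range R.hLin) {z : R.Algebra}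
    (hz : z ∈ LieSubalgebra.lieSpan K R.Algebra (Set.range x)) :
    ⁅y, z⁆ ∈ LinearMap.range R.hLin ⊔
      (LieSubalgebra.lieSpan K R.Algebra (Set.range x)).toSubmodule := by
  have hb : ∀ a ∈ LinearMap.range R.hLin ⊔
      (LieSubalgebra.lieSpan K R.Algebra (Set.range x)).toSubmodule,
      ∀ b ∈ LieSubalgebra.lieSpan K R.Algebra (Set.range x),
      ⁅a, b⁆ ∈ LieSubalgebra.lieSpan K R.Algebra (Set.range x) := by
    intro a ha b hb
    obtain ⟨_, ⟨t, rfl⟩, c, hc, rfl⟩ := Submodule.mem_sup.1 ha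
    rw [add_lie]
    exact add_mem (R.lie_h_mem_lieSpan hx t hb) (LieSubalgebra.lie_mem _ hc hb)
  induction hz using LieSubalgebra.lieSpan_induction with
  | mem z hz =>
    obtain ⟨j, rfl⟩ := hz
    exact Submodule.mem_sup_left (hy j)
  | zero => rw [lie_zero]; exact zero_mem _
  | add y z _ _ h1 h2 => rw [lie_add]; exact add_mem h1 h2
  | smul c y _ h => rw [lie_smul]; exact Submodule.smul_mem _ _ h
  | lie z w hz hw h1 h2 =>
    rw [leibniz_lie]
    refine Submodule.mem_sup_right (add_mem (hb _ h1 _ hw) ?_)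
    rw [← lie_skew]
    exact neg_mem (hb _ h2 _ hz)

/-- The triangular decomposition `𝔤(A) = 𝔫₋ + 𝔥 + 𝔫₊`. -/
theorem triangular_decomposition :
    LinearMap.range R.hLin ⊔ (LieSubalgebra.lieSpan K R.Algebra (Set.range R.e)).toSubmodule ⊔
      (LieSubalgebra.lieSpan K R.Algebra (Set.range R.f)).toSubmodule = ⊤ := by
  set P := (LieSubalgebra.lieSpan K R.Algebra (Set.range R.e)).toSubmodule with hP
  set N := (LieSubalgebra.lieSpan K R.Algebra (Set.range R.f)).toSubmodule with hN
  set M := LinearMap.range R.hLin ⊔ P ⊔ N with hM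
  have hHM : LinearMap.range R.hLin ≤ M := le_sup_left.trans le_sup_left
  have hPM : P ≤ M := le_sup_right.trans le_sup_left
  have hNM : N ≤ M := le_sup_right
  have heP (i) : R.e i ∈ P := LieSubalgebra.subset_lieSpan ⟨i, rfl⟩
  have hfN (i) : R.f i ∈ N := LieSubalgebra.subset_lieSpan ⟨i, rfl⟩
  have hef (i j) : ⁅R.e i, R.f j⁆ ∈ LinearMap.range R.hLin := by
    rcases eq_or_ne i j with rfl | hij
    · rw [lie_e_f_same]
      exact ⟨_, rfl⟩
    · rw [R.lie_e_f_ne hij]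
      exact zero_mem _
  -- The stabilizer of the sum `M` is a Lie subalgebra by the Jacobi identity. It contains the
  -- generators, so `M` is an ideal, in particular a subalgebra, and itself contains the generators.
  let S : LieSubalgebra K R.Algebra :=
    { carrier := {x | ∀ y ∈ M, ⁅x, y⁆ ∈ M}
      add_mem' := fun ha hb y hy => by rw [add_lie]; exact M.add_mem (ha y hy) (hb y hy)
      zero_mem' := fun y _ => by rw [zero_lie]; exact M.zero_mem
      smul_mem' := fun c x hx y hy => by rw [smul_lie]; exact M.smul_mem c (hx y hy)
      lie_mem' := fun {a b} ha hb y hy => by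
        rw [lie_lie]
        exact M.sub_mem (ha _ (hb y hy)) (hb _ (ha y hy)) }
  have hS : S = ⊤ := by
    refine R.eq_top_of_generators_mem (fun t y hy => ?_) (fun i y hy => ?_) (fun i y hy => ?_) <;>
    · obtain ⟨a, ha, c, hc, rfl⟩ := Submodule.mem_sup.1 hy
      obtain ⟨_, ⟨u, rfl⟩, b, hb, rfl⟩ := Submodule.mem_sup.1 ha
      rw [lie_add, lie_add, hLin_apply]
      refine M.add_mem (M.add_mem ?_ ?_) ?_
      · first
        | rw [lie_h_h]; exact zero_mem _
        | rw [← lie_skew, lie_h_e]; exact neg_mem (M.smul_mem _ (hPM (heP i)))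
        | rw [← lie_skew, lie_h_f, neg_neg]; exact M.smul_mem _ (hNM (hfN i))
      · first
        | exact hPM (R.lie_h_mem_lieSpan R.e_mem_rootSpace t hb)
        | exact hPM (LieSubalgebra.lie_mem _ (heP i) hb)
        | refine sup_le hHM hPM (R.lie_mem_lieSpan_sup_range R.e_mem_rootSpace (fun j => ?_) hb)
          rw [← lie_skew]
          exact neg_mem (hef j i)
      · first
        | exact hNM (R.lie_h_mem_lieSpan R.f_mem_rootSpace t hc)
        | exact hNM (LieSubalgebra.lie_mem _ (hfN i) hc)
        | exact sup_le hHM hNM (R.lie_mem_lieSpan_sup_range R.f_mem_rootSpace (hef i) hc)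
  let M' : LieSubalgebra K R.Algebra :=
    { M with lie_mem' := fun {a b} _ hb => (hS ▸ LieSubalgebra.mem_top a : a ∈ S) b hb }
  have hM' : M' = ⊤ := R.eq_top_of_generators_mem (fun t => hHM ⟨t, rfl⟩)
    (fun i => hPM (heP i)) (fun i => hNM (hfN i))
  rw [eq_top_iff]
  intro x _
  exact (hM' ▸ LieSubalgebra.mem_top x : x ∈ M')

/-- Root spaces are joint eigenspaces of the commuting operators `ad (h t)`. -/
theorem iSupIndep_rootSpace : iSupIndep R.rootSpace := by
  have hcomm (s t : H) : Commute (LieAlgebra.ad K R.Algebra (R.h s))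
      (LieAlgebra.ad K R.Algebra (R.h t)) := by
    ext x
    simp only [Module.End.mul_apply, LieAlgebra.ad_apply]
    rw [leibniz_lie, lie_h_h, zero_lie, zero_add]
  have h := Module.End.independent_iInf_maxGenEigenspace_of_forall_mapsTo
    (fun t : H => LieAlgebra.ad K R.Algebra (R.h t))
    (fun s t φ => Module.End.mapsTo_maxGenEigenspace_of_comm (hcomm t s) φ)
  refine (h.comp (f := fun β : Module.Dual K H => (β : H → K)) DFunLike.coe_injective).mono ?_
  intro β x hx
  simp only [Function.comp_apply, Submodule.mem_iInf]
  intro t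
  exact (Module.End.mem_maxGenEigenspace _ _ _).2 ⟨1, by simp [hx t]⟩

/-- Spanning vectors of the root spaces that follow from the triangular decomposition. -/
def rootSpanningSet (k : Fin n → ℤ) : Set R.Algebra :=
  {x | x ∈ R.rootSpace (R.wt k) ∧ (k = 0 ∨ (∃ j, k = Pi.single j 1 ∧ x = R.e j) ∨ k ≤ 0 ∨
    (0 ≤ k ∧ 2 ≤ ∑ i, k i))}

/-- These spans lie in the independent root spaces and together fill the algebra, so none can be
smaller than its root space. The content is at simple roots and at mixed signs; elsewhere the
spanning set is the whole root space. -/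
theorem rootSpace_eq_span [CharZero K] (k : Fin n → ℤ) :
    R.rootSpace (R.wt k) = Submodule.span K (R.rootSpanningSet k) := by
  have h1 : iSupIndep fun k => R.rootSpace (R.wt k) := R.iSupIndep_rootSpace.comp R.wt_injective
  have h2 : ⨆ k, Submodule.span K (R.rootSpanningSet k) = ⊤ := by
    have hle (k) (x) (hx : x ∈ R.rootSpanningSet k) :
        x ∈ ⨆ k, Submodule.span K (R.rootSpanningSet k) :=
      Submodule.mem_iSup_of_mem k (Submodule.subset_span hx)
    rw [eq_top_iff, ← R.triangular_decomposition]
    refine sup_le (sup_le ?_ ?_) ?_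
    · rintro _ ⟨t, rfl⟩
      refine hle 0 _ ⟨fun s => ?_, Or.inl rfl⟩
      rw [hLin_apply, lie_h_h]
      simp [wt]
    · intro x hx
      refine Submodule.span_le.2 ?_ (R.lieSpan_le_span 1 R.e
        (fun j => by rw [one_smul]; exact R.e_mem_rootSpace j) hx)
      rintro _ (⟨j, rfl⟩ | ⟨k, h0, h2, hk⟩)
      · exact hle (Pi.single j 1) _ ⟨R.e_mem_rootSpace j, Or.inr (Or.inl ⟨j, rfl, rfl⟩)⟩
      · rw [one_smul] at hk
        exact hle k _ ⟨hk, Or.inr (Or.inr (Or.inr ⟨h0, h2⟩))⟩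
    · intro x hx
      refine Submodule.span_le.2 ?_ (R.lieSpan_le_span (-1) R.f
        (fun j => by rw [neg_one_smul]; exact R.f_mem_rootSpace j) hx)
      rintro _ (⟨j, rfl⟩ | ⟨k, h0, h2, hk⟩)
      · exact hle (-Pi.single j 1) _ ⟨R.f_mem_rootSpace j,
          Or.inr (Or.inr (Or.inl (by simp [Pi.single_nonneg])))⟩
      · rw [neg_one_smul] at hk
        exact hle (-k) _ ⟨hk, Or.inr (Or.inr (Or.inl (by simpa using h0)))⟩
  have h3 := (h1.le_iff_eq_of_iSup_eq_top h2).1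
    (fun k => Submodule.span_le.2 fun x hx => hx.1)
  exact (congrFun h3 k).symm

/-- The root space of a simple root is spanned by the Chevalley generator. -/
theorem exists_eq_smul_e [CharZero K] {j : Fin n} {x : R.Algebra}
    (hx : x ∈ R.rootSpace (R.wt (Pi.single j 1))) : ∃ c : K, x = c • R.e j := by
  rw [rootSpace_eq_span] at hx
  have hle : R.rootSpanningSet (Pi.single j 1) ⊆ {R.e j} := by
    rintro y ⟨-, h | ⟨i, h, rfl⟩ | h | ⟨-, h⟩⟩
    · simp at h
    · have := congrFun h j
      rcases eq_or_ne i j with rfl | hij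
      · rfl
      · simp [hij.symm] at this
    · have := h j
      simp at this
    · simp at h
  obtain ⟨c, hc⟩ := Submodule.mem_span_singleton.1 (Submodule.span_mono hle hx)
  exact ⟨c, hc.symm⟩

/-- The coordinates of a root do not have mixed signs. -/
theorem nonneg_of_mem_rootSpace [CharZero K] {k : Fin n → ℤ} {j : Fin n} (hj : 0 < k j)
    {x : R.Algebra} (hx : x ∈ R.rootSpace (R.wt k)) (hx0 : x ≠ 0) : 0 ≤ k := by
  by_contra hk
  have hle : R.rootSpanningSet k ⊆ {0} := by
    rintro y ⟨-, h | ⟨i, h, rfl⟩ | h | ⟨h, -⟩⟩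
    · exact absurd h.ge hk
    · exact absurd (by rw [h]; simp [Pi.single_nonneg]) hk
    · exact absurd (h j) (not_le.2 hj)
    · exact absurd h hk
  rw [rootSpace_eq_span] at hx
  exact hx0 (by simpa using Submodule.span_mono hle hx)

end Realization

/-! ### The Weyl-invariant quadratic form -/

namespace GCM

variable (A)

theorem IsSimplyLaced.symm {A : GCM n} (hsl : A.IsSimplyLaced) (i j : Fin n) :
    A.a i j = A.a j i := by
  rcases eq_or_ne i j with rfl | hij
  · rfl
  · have h := A.zero_iff i j hij
    rcases hsl i j hij with h1 | h1 <;> rcases hsl j i hij.symm with h2 | h2 <;> omega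

/-- The value of the weight with coordinates `k` at the simple coroot `α i ^∨`. -/
def pairing (k : Fin n → ℤ) (i : Fin n) : ℤ := ∑ j, A.a i j * k j

/-- The integral quadratic form defined by the Cartan matrix. -/
def quadForm (k : Fin n → ℤ) : ℤ := ∑ i, k i * A.pairing k i

theorem pairing_sub_single (k : Fin n → ℤ) (i l : Fin n) (c : ℤ) :
    A.pairing (k - Pi.single i c) l = A.pairing k l - A.a l i * c := by
  simp [pairing, mul_sub, Finset.sum_sub_distrib, Pi.single_apply]

theorem pairing_single (i l : Fin n) (c : ℤ) : A.pairing (Pi.single i c) l = A.a l i * c := by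
  simp [pairing, Pi.single_apply]

theorem quadForm_single (i : Fin n) (c : ℤ) : A.quadForm (Pi.single i c) = 2 * c ^ 2 := by
  simp [quadForm, pairing_single, Pi.single_apply, A.diag]
  ring

theorem quadForm_reflection (hsl : A.IsSimplyLaced) (k : Fin n → ℤ) (i : Fin n) :
    A.quadForm (k - Pi.single i (A.pairing k i)) = A.quadForm k := by
  have h : ∑ l, k l * A.a l i = A.pairing k i := by
    simp only [pairing, hsl.symm _ i, mul_comm]
  simp only [quadForm, pairing_sub_single, Pi.sub_apply, sub_mul, mul_sub, Pi.single_apply,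
    Finset.sum_sub_distrib, ite_mul, zero_mul, Finset.sum_ite_eq', Finset.mem_univ, if_true,
    ← mul_assoc, ← Finset.sum_mul, h, A.diag]
  ring

end GCM

/-! ### Real roots and lowering of root vectors -/

namespace Realization

variable (R : Realization A K H)

theorem exists_coordinates_of_isRealRoot (hsl : A.IsSimplyLaced) {β : Module.Dual K H}
    (hβ : R.IsRealRoot β) : ∃ k, β = R.wt k ∧ A.quadForm k = 2 := by
  obtain ⟨w, hw, i, rfl⟩ := hβ
  have hrefl : ∀ i γ, (∃ k, γ = R.wt k ∧ A.quadForm k = 2) →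
      ∃ k, R.simpleReflection i γ = R.wt k ∧ A.quadForm k = 2 := by
    rintro i _ ⟨k, rfl, hk⟩
    refine ⟨k - Pi.single i (A.pairing k i), ?_, (A.quadForm_reflection hsl k i).trans hk⟩
    rw [sub_eq_add_neg, ← Pi.single_neg, wt_add, wt_single, simpleReflection,
      Module.reflection_apply, Module.Dual.eval_apply, wt_coroot, sub_eq_add_neg]
    ext t
    simp [GCM.pairing]
  -- An equivalence for all `γ` passes to inverses in the group generated by the reflections.
  have key : ∀ γ, (∃ k, w γ = R.wt k ∧ A.quadForm k = 2) ↔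
      ∃ k, γ = R.wt k ∧ A.quadForm k = 2 := by
    induction hw using Subgroup.closure_induction with
    | mem x hx =>
      obtain ⟨i, rfl⟩ := hx
      refine fun γ => ⟨fun h => ?_, hrefl i γ⟩
      have h := hrefl i _ h
      rwa [simpleReflection, Module.involutive_reflection] at h
    | one => exact fun γ => Iff.rfl
    | mul x y _ _ hx hy => exact fun γ => (hx _).trans (hy γ)
    | inv x _ hx =>
      intro γ
      rw [← hx, ← LinearEquiv.mul_apply, mul_inv_cancel]
      rfl
  exact (key _).2 ⟨Pi.single i 1, by rw [wt_single, one_smul], by rw [GCM.quadForm_single]; rfl⟩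

theorem lie_f_e_ne {i j : Fin n} (hij : i ≠ j) : ⁅R.f i, R.e j⁆ = 0 := by
  rw [← lie_skew, R.lie_e_f_ne hij.symm, neg_zero]

/-- Recovers a lowest weight vector `z` from `⁅z, e i⁆` when its weight at `α i ^∨` is nonzero. -/
theorem lie_f_lie_e {i : Fin n} {z : R.Algebra} (hz : ⁅R.f i, z⁆ = 0) :
    ⁅R.f i, ⁅z, R.e i⁆⁆ = ⁅R.h (R.coroot i), z⁆ := by
  rw [leibniz_lie, hz, zero_lie, zero_add, ← lie_skew (R.f i), lie_e_f_same, lie_neg, lie_skew]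

theorem ad_pow_lie_of_lie_eq_zero {y z : R.Algebra} (hz : ⁅y, z⁆ = 0) (u : R.Algebra) (m : ℕ) :
    (LieAlgebra.ad K R.Algebra y ^ m) ⁅z, u⁆ = ⁅z, (LieAlgebra.ad K R.Algebra y ^ m) u⁆ := by
  induction m with
  | zero => rfl
  | succ m ih =>
    rw [pow_succ', Module.End.mul_apply, ih, LieAlgebra.ad_apply, leibniz_lie, hz, zero_lie,
      zero_add]
    rfl

theorem ad_pow_mem {L : LieSubalgebra K R.Algebra} {y u : R.Algebra} (hy : y ∈ L) (hu : u ∈ L)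
    (m : ℕ) : (LieAlgebra.ad K R.Algebra y ^ m) u ∈ L := by
  induction m with
  | zero => exact hu
  | succ m ih =>
    rw [pow_succ', Module.End.mul_apply]
    exact L.lie_mem hy ih

theorem ad_f_pow_mem_rootSpace {k : Fin n → ℤ} {u : R.Algebra} (hu : u ∈ R.rootSpace (R.wt k))
    (i : Fin n) (m : ℕ) :
    (LieAlgebra.ad K R.Algebra (R.f i) ^ m) u ∈ R.rootSpace (R.wt (k - Pi.single i (m : ℤ))) := by
  induction m with
  | zero => simpa using hu
  | succ m ih =>
    rw [pow_succ', Module.End.mul_apply]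
    have h := R.lie_mem_rootSpace (R.f_mem_rootSpace i) ih
    rw [← wt_add] at h
    rwa [show -Pi.single i 1 + (k - Pi.single i (m : ℤ)) = k - Pi.single i ((m + 1 : ℕ) : ℤ) by
      rw [Nat.cast_succ, Pi.single_add]; abel] at h

theorem ad_e_ad_f (i : Fin n) (x : R.Algebra) :
    LieAlgebra.ad K R.Algebra (R.e i) (LieAlgebra.ad K R.Algebra (R.f i) x) =
      LieAlgebra.ad K R.Algebra (R.f i) (LieAlgebra.ad K R.Algebra (R.e i) x) +
        LieAlgebra.ad K R.Algebra (R.h (R.coroot i)) x := by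
  simp only [LieAlgebra.ad_apply]
  rw [leibniz_lie, lie_e_f_same, add_comm]

theorem ad_h_ad_e (i : Fin n) (x : R.Algebra) :
    LieAlgebra.ad K R.Algebra (R.h (R.coroot i)) (LieAlgebra.ad K R.Algebra (R.e i) x) =
      LieAlgebra.ad K R.Algebra (R.e i) (LieAlgebra.ad K R.Algebra (R.h (R.coroot i)) x) +
        (2 : K) • LieAlgebra.ad K R.Algebra (R.e i) x := by
  simp only [LieAlgebra.ad_apply]
  rw [leibniz_lie, lie_h_e, R.root_coroot, A.diag, add_comm, smul_lie, Int.cast_ofNat]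

theorem ad_h_ad_f (i : Fin n) (x : R.Algebra) :
    LieAlgebra.ad K R.Algebra (R.h (R.coroot i)) (LieAlgebra.ad K R.Algebra (R.f i) x) =
      LieAlgebra.ad K R.Algebra (R.f i) (LieAlgebra.ad K R.Algebra (R.h (R.coroot i)) x) -
        (2 : K) • LieAlgebra.ad K R.Algebra (R.f i) x := by
  simp only [LieAlgebra.ad_apply]
  rw [leibniz_lie, lie_h_f, R.root_coroot, A.diag, neg_lie, smul_lie, add_comm, Int.cast_ofNat,
    sub_eq_add_neg]

/-- A nonzero root vector of a positive real root that is not simple can be lowered to a nonzero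
root vector of a positive real root of smaller height. -/
theorem exists_descent [CharZero K] (hsl : A.IsSimplyLaced) {k : Fin n → ℤ} (hk : 0 ≤ k)
    (hq : A.quadForm k = 2) {u : R.Algebra} (hu : u ∈ R.rootSpace (R.wt k)) (hu0 : u ≠ 0) :
    (∃ j, k = Pi.single j 1) ∨ ∃ (i : Fin n) (m : ℕ) (k' : Fin n → ℤ),
      0 ≤ k' ∧ A.quadForm k' = 2 ∧ ∑ l, k' l < ∑ l, k l ∧ 0 < k i ∧ (∀ l, l ≠ i → k' l = k l) ∧
      A.pairing k' i ≠ 0 ∧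
      (LieAlgebra.ad K R.Algebra (R.f i) ^ (m + 1)) u ∈ R.rootSpace (R.wt k') ∧
      (LieAlgebra.ad K R.Algebra (R.f i) ^ (m + 1)) u ≠ 0 ∧
      (k' i = 0 → ⁅R.e i, (LieAlgebra.ad K R.Algebra (R.f i) ^ (m + 1)) u⁆ =
        ((m + 1 : ℕ) : K) • (LieAlgebra.ad K R.Algebra (R.f i) ^ m) u) := by
  -- The form is the sum of these products and equals 2, so one of them is positive.
  obtain ⟨i, -, hi⟩ : ∃ i ∈ Finset.univ, 0 < k i * A.pairing k i :=
    Finset.exists_lt_of_sum_lt (by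
      rw [Finset.sum_const_zero]
      exact (by omega : 0 < A.quadForm k))
  have hki : 0 < k i := lt_of_le_of_ne (hk i) fun h => by simp [← h] at hi
  have hpi : 0 < A.pairing k i := (mul_pos_iff_of_pos_left hki).1 hi
  by_cases hl : ∃ l, l ≠ i ∧ 0 < k l
  swap
  · left
    push Not at hl
    have hks : k = Pi.single i (k i) := by
      funext l
      rcases eq_or_ne l i with rfl | hli
      · simp
      · rw [Pi.single_eq_of_ne hli]
        exact le_antisymm (hl l hli) (hk l)
    refine ⟨i, ?_⟩
    rw [hks, GCM.quadForm_single] at hq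
    rw [hks, show k i = 1 by nlinarith]
  right
  obtain ⟨l, hli, hkl⟩ := hl
  obtain ⟨m, hm⟩ : ∃ m : ℕ, A.pairing k i = ((m + 1 : ℕ) : ℤ) :=
    ⟨(A.pairing k i - 1).toNat, by omega⟩
  have hEF := R.ad_e_ad_f i
  have hTE := R.ad_h_ad_e i
  have hTF := R.ad_h_ad_f i
  obtain ⟨N, hN⟩ := R.exists_ad_e_pow_eq_zero i u
  have hTu : LieAlgebra.ad K R.Algebra (R.h (R.coroot i)) u = ((m + 1 : ℕ) : K) • u := by
    rw [LieAlgebra.ad_apply, hu, wt_coroot]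
    rw [GCM.pairing] at hm
    rw [hm, Int.cast_natCast]
  have hmem := R.ad_f_pow_mem_rootSpace hu i (m + 1)
  have hne : (LieAlgebra.ad K R.Algebra (R.f i) ^ (m + 1)) u ≠ 0 := fun h =>
    hu0 (sl2_eq_zero_of_pow_lower_eq_zero hEF hTE hTF N (m + 1) u hTu hN h)
  refine ⟨i, m, k - Pi.single i ((m + 1 : ℕ) : ℤ), ?_⟩
  refine ⟨?_, ?_, ?_, hki, ?_, ?_, hmem, hne, ?_⟩
  -- The reflection leaves the positive coordinate at `l` unchanged, and roots have no mixed signs.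
  · exact R.nonneg_of_mem_rootSpace (j := l) (by simpa [hli] using hkl) hmem hne
  · rw [← hm, A.quadForm_reflection hsl, hq]
  · simp only [Pi.sub_apply, Finset.sum_sub_distrib, Finset.sum_pi_single', Finset.mem_univ,
      if_true]
    omega
  · intro l hli
    simp [hli]
  · rw [GCM.pairing_sub_single, A.diag]
    omega
  · intro hk0
    -- One more `f i` would make the coordinate at `i` equal to `-1` while that at `l` stays
    -- positive, so the vector vanishes.
    refine sl2_raise_lowest hEF hTE hTF hTu hN ?_
    by_contra hne2
    have h := R.nonneg_of_mem_rootSpace (j := l) (by simpa [hli] using hkl)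
      (R.ad_f_pow_mem_rootSpace hu i (m + 2)) hne2 i
    simp at h hk0
    omega

/-- If `z` is a lowest weight vector for the Chevalley generators in the support of a positive
real root `γ`, of nontrivial weight, and if a Lie subalgebra containing these generators
contains `⁅z, e_γ⁆`, then it contains `z`. -/
theorem mem_of_lie_mem [CharZero K] (hsl : A.IsSimplyLaced) {L : LieSubalgebra K R.Algebra}
    (hf : ∀ i, R.f i ∈ L) (N : ℕ) : ∀ k : Fin n → ℤ, 0 ≤ k → A.quadForm k = 2 →
    ∑ l, k l < N → ∀ u ∈ R.rootSpace (R.wt k), u ≠ 0 → (∀ l, 0 < k l → R.e l ∈ L) →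
    ∀ (z : R.Algebra) (w : Fin n → ℤ), (∀ l, 0 < k l → ⁅R.h (R.coroot l), z⁆ = (w l : K) • z) →
    (∀ l, 0 < k l → ⁅R.f l, z⁆ = 0) → (∃ l, 0 < k l ∧ w l ≠ 0) → ⁅z, u⁆ ∈ L → z ∈ L := by
  induction N with
  | zero => exact fun k hk _ hN =>
      absurd hN (not_lt.2 (by exact_mod_cast Finset.sum_nonneg fun l _ => hk l))
  | succ N ih =>
    intro k hk hq hN u hu hu0 he z w hw hfz hl hzu
    have final (i : Fin n) (hi : 0 < k i) (hwi : w i ≠ 0) (h : ⁅z, R.e i⁆ ∈ L) : z ∈ L := by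
      have h2 := L.lie_mem (hf i) h
      rw [R.lie_f_lie_e (hfz i hi), hw i hi] at h2
      exact (L.toSubmodule.smul_mem_iff (Int.cast_ne_zero.2 hwi)).1 h2
    rcases R.exists_descent hsl hk hq hu hu0 with
      ⟨j, rfl⟩ | ⟨i, m, k', hk', hq', hlt, hki, hkk', hp, hu', hu0', hraise⟩
    · obtain ⟨c, rfl⟩ := R.exists_eq_smul_e hu
      have hc : c ≠ 0 := fun h => hu0 (by rw [h, zero_smul])
      obtain ⟨l, hl, hwl⟩ := hl
      obtain rfl : l = j := by
        by_contra h
        simp [h] at hl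
      rw [lie_smul] at hzu
      exact final l hl hwl ((L.toSubmodule.smul_mem_iff hc).1 hzu)
    · set u' := (LieAlgebra.ad K R.Algebra (R.f i) ^ (m + 1)) u with hu'_def
      have hsub (l) (h : 0 < k' l) : 0 < k l := by
        rcases eq_or_ne l i with rfl | hli
        · exact hki
        · rwa [← hkk' l hli]
      have hpow (r : ℕ) : ⁅z, (LieAlgebra.ad K R.Algebra (R.f i) ^ r) u⁆ ∈ L := by
        rw [← R.ad_pow_lie_of_lie_eq_zero (hfz i hki)]
        exact R.ad_pow_mem (hf i) hzu r
      have hN' : ∑ l, k' l < N := by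
        push_cast at hN
        omega
      by_cases hex : ∃ l, 0 < k' l ∧ w l ≠ 0
      · exact ih k' hk' hq' hN' u' hu' hu0' (fun l h => he l (hsub l h)) z w
          (fun l h => hw l (hsub l h)) (fun l h => hfz l (hsub l h)) hex (hpow (m + 1))
      push Not at hex
      obtain ⟨l, hl, hwl⟩ := hl
      obtain rfl : l = i := by
        by_contra hli
        exact hwl (hex l (by rwa [hkk' l hli]))
      -- Remaining case: the weight of `z` is nonzero only at the index just removed from the
      -- support. The induction is applied to `⁅z, e l⁆` instead, whose weight on the new support is
      -- `a j l`.
      have hk'0 : k' l = 0 := le_antisymm (not_lt.1 fun h => hwl (hex l h)) (hk' l)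
      have hne (j) (h : 0 < k' j) : j ≠ l := by
        rintro rfl
        omega
      refine final l hl hwl (ih k' hk' hq' hN' u' hu' hu0' (fun j h => he j (hsub j h)) _
        (fun j => w j + A.a j l) (fun j h => ?_) (fun j h => ?_) ?_ ?_)
      · rw [leibniz_lie, hw j (hsub j h), lie_h_e, R.root_coroot, smul_lie, lie_smul, ← add_smul,
          Int.cast_add]
      · rw [leibniz_lie, hfz j (hsub j h), zero_lie, zero_add, R.lie_f_e_ne (hne j h), lie_zero]
      -- A nonzero pairing of `k'` with `α l ^∨` forces a neighbour `j` of `l` in the support of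
      -- `k'`.
      · obtain ⟨j, -, hj⟩ := Finset.exists_ne_zero_of_sum_ne_zero hp
        have hj2 : 0 < k' j := lt_of_le_of_ne (hk' j) (right_ne_zero_of_mul hj).symm
        refine ⟨j, hj2, ?_⟩
        rw [hex j hj2, zero_add, hsl.symm]
        exact left_ne_zero_of_mul hj
      -- `⁅⁅z, e l⁆, u'⁆ = ⁅z, ⁅e l, u'⁆⁆ - ⁅e l, ⁅z, u'⁆⁆`, where `⁅e l, u'⁆` is a multiple of
      -- `ad(f l)^m u`.
      · rw [lie_lie, hraise hk'0, lie_smul]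
        exact sub_mem (L.smul_mem _ (hpow m)) (L.lie_mem (he l hl) (hpow (m + 1)))

/-- A Lie subalgebra that contains all `f i` and a root vector of a positive real root contains
all `e i` in the support of the root. -/
theorem e_mem_of_root_vector_mem [CharZero K] (hsl : A.IsSimplyLaced)
    {L : LieSubalgebra K R.Algebra} (hf : ∀ i, R.f i ∈ L) (N : ℕ) : ∀ k : Fin n → ℤ, 0 ≤ k →
    A.quadForm k = 2 → ∑ l, k l < N → ∀ u ∈ R.rootSpace (R.wt k), u ≠ 0 → u ∈ L →
    ∀ l, 0 < k l → R.e l ∈ L := by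
  induction N with
  | zero => exact fun k hk _ hN =>
      absurd hN (not_lt.2 (by exact_mod_cast Finset.sum_nonneg fun l _ => hk l))
  | succ N ih =>
    intro k hk hq hN u hu hu0 huL l hl
    rcases R.exists_descent hsl hk hq hu hu0 with
      ⟨j, rfl⟩ | ⟨i, m, k', hk', hq', hlt, hki, hkk', hp, hu', hu0', hraise⟩
    · obtain ⟨c, rfl⟩ := R.exists_eq_smul_e hu
      have hc : c ≠ 0 := fun h => hu0 (by rw [h, zero_smul])
      obtain rfl : l = j := by
        by_contra h
        simp [h] at hl
      exact (L.toSubmodule.smul_mem_iff hc).1 huL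
    · have hN' : ∑ l, k' l < N := by
        push_cast at hN
        omega
      have he := ih k' hk' hq' hN' _ hu' hu0' (R.ad_pow_mem (hf i) huL (m + 1))
      rcases (hk' l).lt_or_eq with hl' | hl'
      · exact he l hl'
      obtain rfl : l = i := by
        by_contra hli
        rw [hkk' l hli] at hl'
        exact hl.ne hl'
      -- Since `l` is outside the support of `k'`, `e l` is killed by every `f j` with `j` in that
      -- support.
      refine R.mem_of_lie_mem hsl hf N k' hk' hq' hN' _ hu' hu0' he (R.e l) (fun j => A.a j l)
        (fun j _ => by rw [lie_h_e, R.root_coroot]) (fun j h => R.lie_f_e_ne ?_) ?_ ?_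
      · rintro rfl
        exact h.ne hl'
      · obtain ⟨j, -, hj⟩ := Finset.exists_ne_zero_of_sum_ne_zero hp
        refine ⟨j, lt_of_le_of_ne (hk' j) (right_ne_zero_of_mul hj).symm, ?_⟩
        rw [hsl.symm]
        exact left_ne_zero_of_mul hj
      · rw [hraise hl'.symm]
        exact L.smul_mem _ (R.ad_pow_mem (hf l) huL m)

/-! ### The derived algebra and the conclusion -/

theorem mem_derivedAlgebra_of_weight_ne_zero {β : Module.Dual K H} {x : R.Algebra}
    (hx : x ∈ R.rootSpace β) {t : H} (ht : β t ≠ 0) : x ∈ R.derivedAlgebra := by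
  have h : x = ⁅(β t)⁻¹ • R.h t, x⁆ := by rw [smul_lie, hx t, inv_smul_smul₀ ht]
  change x ∈ (LieAlgebra.derivedSeries K R.Algebra 1 : Submodule K R.Algebra)
  rw [LieAlgebra.coe_derivedSeries_one_eq, h]
  exact Submodule.subset_span ⟨_, _, rfl⟩

/-- The derived algebra is contained in every Lie subalgebra containing the Chevalley
generators. -/
theorem derivedAlgebra_le {L : LieSubalgebra K R.Algebra} (he : ∀ i, R.e i ∈ L)
    (hf : ∀ i, R.f i ∈ L) : R.derivedAlgebra ≤ L := by
  let M := LieSubalgebra.lieSpan K R.Algebra (Set.range (Sum.elim R.e R.f))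
  have hML : M ≤ L := by
    refine LieSubalgebra.lieSpan_le.2 ?_
    rintro _ ⟨i | i, rfl⟩
    exacts [he i, hf i]
  have hhM (t : H) {z} (hz : z ∈ M) : ⁅R.h t, z⁆ ∈ M := by
    induction hz using LieSubalgebra.lieSpan_induction with
    | mem y hy =>
      obtain ⟨i | i, rfl⟩ := hy
      · rw [Sum.elim_inl, lie_h_e]
        exact M.smul_mem _ (LieSubalgebra.subset_lieSpan ⟨Sum.inl i, rfl⟩)
      · rw [Sum.elim_inr, lie_h_f]
        exact neg_mem (M.smul_mem _ (LieSubalgebra.subset_lieSpan ⟨Sum.inr i, rfl⟩))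
    | zero => rw [lie_zero]; exact zero_mem _
    | add y z _ _ h1 h2 => rw [lie_add]; exact add_mem h1 h2
    | smul c y _ h => rw [lie_smul]; exact M.smul_mem _ h
    | lie y z hy hz h1 h2 =>
      rw [leibniz_lie]
      exact add_mem (M.lie_mem h1 hz) (M.lie_mem hy h2)
  -- As `𝔥` is abelian and normalizes `M`, all brackets of `𝔥 + M` lie in `M`; and `𝔥 + M` is the
  -- whole algebra.
  have hbr : ∀ x ∈ LinearMap.range R.hLin ⊔ M.toSubmodule,
      ∀ y ∈ LinearMap.range R.hLin ⊔ M.toSubmodule, ⁅x, y⁆ ∈ M := by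
    intro x hx y hy
    obtain ⟨_, ⟨s, rfl⟩, a, ha, rfl⟩ := Submodule.mem_sup.1 hx
    obtain ⟨_, ⟨t, rfl⟩, b, hb, rfl⟩ := Submodule.mem_sup.1 hy
    rw [add_lie, lie_add, lie_add, hLin_apply, hLin_apply, lie_h_h, zero_add,
      ← lie_skew a (R.h t)]
    exact add_mem (hhM s hb) (add_mem (neg_mem (hhM t ha)) (M.lie_mem ha hb))
  let S : LieSubalgebra K R.Algebra :=
    { LinearMap.range R.hLin ⊔ M.toSubmodule with
      lie_mem' := fun {a b} ha hb => Submodule.mem_sup_right (hbr a ha b hb) }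
  have hS : S = ⊤ := R.eq_top_of_generators_mem (fun t => Submodule.mem_sup_left ⟨t, rfl⟩)
    (fun i => Submodule.mem_sup_right (LieSubalgebra.subset_lieSpan ⟨Sum.inl i, rfl⟩))
    (fun i => Submodule.mem_sup_right (LieSubalgebra.subset_lieSpan ⟨Sum.inr i, rfl⟩))
  have hS' (x) : x ∈ S := hS ▸ LieSubalgebra.mem_top x
  refine le_trans (b := M) ?_ hML
  intro x hx
  change x ∈ (LieAlgebra.derivedSeries K R.Algebra 1 : Submodule K R.Algebra) at hx
  rw [LieAlgebra.coe_derivedSeries_one_eq] at hx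
  refine Submodule.span_le (p := M.toSubmodule).2 ?_ hx
  rintro _ ⟨a, b, rfl⟩
  exact hbr a (hS' a) b (hS' b)

end Realization

end KacMoody

end

theorem mainTheorem7 {n : ℕ} (A : KacMoody.GCM n) (hirr : A.IsIrreducible)
    (hsl : A.IsSimplyLaced) {K : Type*} [RCLike K] {H : Type*} [AddCommGroup H] [Module K H]
    (R : KacMoody.Realization A K H) (β : Module.Dual K H) (hreal : R.IsRealRoot β)
    (hpos : R.IsPositive β) (hsupp : R.HasMaximalSupport β)
    (eβ : R.Algebra) (heβ : eβ ∈ R.rootSpace β) (heβ0 : eβ ≠ 0) :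
    LieSubalgebra.lieSpan K R.Algebra (insert eβ (Set.range R.f)) = R.derivedAlgebra := by
  obtain ⟨k, rfl, hq⟩ := R.exists_coordinates_of_isRealRoot hsl hreal
  obtain ⟨p, hp⟩ := hpos
  obtain ⟨s, hs, hs0⟩ := hsupp
  obtain rfl : k = s := R.wt_injective hs
  have hkp : k = fun i => (p i : ℤ) := R.wt_injective (by simpa [KacMoody.Realization.wt] using hp)
  have hk0 : 0 ≤ k := by
    rw [hkp]
    exact fun i => Int.natCast_nonneg _
  refine le_antisymm (LieSubalgebra.lieSpan_le.2 ?_) (R.derivedAlgebra_le (fun i => ?_)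
    fun i => LieSubalgebra.subset_lieSpan (Or.inr ⟨i, rfl⟩))
  · rintro _ (rfl | ⟨i, rfl⟩)
    · have h0 : R.wt k ≠ 0 := by
        intro h
        have h1 : k = 0 := R.wt_injective (h.trans (by simp [KacMoody.Realization.wt]))
        simp [h1, KacMoody.GCM.quadForm] at hq
      obtain ⟨t, ht⟩ := DFunLike.ne_iff.1 h0
      exact R.mem_derivedAlgebra_of_weight_ne_zero heβ ht
    · refine R.mem_derivedAlgebra_of_weight_ne_zero (R.f_mem_rootSpace i) (t := R.coroot i) ?_
      rw [← Pi.single_neg, R.wt_single]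
      simp [R.root_coroot, A.diag]
  · exact R.e_mem_of_root_vector_mem hsl
      (fun i => LieSubalgebra.subset_lieSpan (Or.inr ⟨i, rfl⟩)) ((∑ l, k l).toNat + 1) k hk0 hq
      (by push_cast; omega) eβ heβ heβ0 (LieSubalgebra.subset_lieSpan (Or.inl rfl)) i
      (lt_of_le_of_ne (hk0 i) (hs0 i).symm)
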